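/- Let $K$ be a field, $n\ge 0$, $S=K[x_1,\dots,x_n]$ and $\mathfrak m=(x_1,\dots,x_n)$. For an ideal $J\subseteq S$ let $\mu(J)$ be the minimal number of generators of $J$, and let $\ell(J)$ be its analytic spread, that is, the Krull dimension of the fiber ring $F(J)=\mathcal R(J)/\mathfrak m\mathcal R(J)$, where $\mathcal R(J)=\bigoplus_{k\ge 0}J^kt^k\subseteq S[t]$ is the Rees ring of $J$. Let $I\subseteq S$ be an equigenerated graded ideal, i.e. an ideal generated by homogeneous polynomials all of the same degree. Let $<$ be any monomial order on $S$, and let $I'$ be the ideal generated by the monomials of degree $d$ in the initial ideal $\operatorname{in}_<(I)$, where $d$ is the least degree with $I_d\neq 0$ (and $I'=0$ if $I=0$). Then $\ell(I')$ is finite and \[ \mu(I^2)\;\ge\;\ell(I')\,\mu(I)-\binom{\ell(I')}{2}. \] If moreover $I$ is a monomial ideal, then $\ell(I)$ is finite and \[ \mu(I^2)\;\ge\;\ell(I)\,\mu(I)-\binom{\ell(I)}{2}. \] -/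

import Mathlib

open MvPolynomial

noncomputable section

namespace FiberRing

universe u

variable {K : Type u} [Field K] {n : ℕ}

/-- The minimal number `μ(I)` of generators of an ideal. (The polynomial ring is Noetherian, so
this is the cardinality of a smallest generating set.) -/
def mu (I : Ideal (MvPolynomial (Fin n) K)) : ℕ :=
  Submodule.spanFinrank I

/-- `I` is an equigenerated graded ideal: it is generated by homogeneous polynomials, all of the
same degree `d`. -/
def IsEquigenerated (I : Ideal (MvPolynomial (Fin n) K)) : Prop :=
  ∃ (d : ℕ) (G : Set (MvPolynomial (Fin n) K)), (∀ f ∈ G, f.IsHomogeneous d) ∧ I = Ideal.span G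

/-- `I` is a monomial ideal: it is generated by monomials. -/
def IsMonomialIdeal (I : Ideal (MvPolynomial (Fin n) K)) : Prop :=
  ∃ A : Set (Fin n →₀ ℕ), I = Ideal.span ((fun a => monomial a (1 : K)) '' A)

/-- The graded maximal ideal `𝔪 = (x₁, …, xₙ)`. -/
def gradedMaximalIdeal (K : Type u) [Field K] (n : ℕ) : Ideal (MvPolynomial (Fin n) K) :=
  Ideal.span (Set.range X)

/-- The fiber ring `F(I) = R(I) / 𝔪 R(I)`, where `R(I) = ⨁ₖ Iᵏ tᵏ ⊆ S[t]` is the Rees ring. -/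
abbrev Fiber (I : Ideal (MvPolynomial (Fin n) K)) : Type u :=
  reesAlgebra I ⧸
    (gradedMaximalIdeal K n).map (algebraMap (MvPolynomial (Fin n) K) (reesAlgebra I))

/-- The analytic spread `ℓ(I)`: the Krull dimension of the fiber ring. -/
def analyticSpread (I : Ideal (MvPolynomial (Fin n) K)) : WithBot ℕ∞ :=
  ringKrullDim (Fiber I)

/-- The initial ideal of `L` with respect to a monomial order: the ideal generated by the leading
monomials of the nonzero elements of `L`. -/
def initialIdeal (m : MonomialOrder (Fin n)) (L : Ideal (MvPolynomial (Fin n) K)) :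
    Ideal (MvPolynomial (Fin n) K) :=
  Ideal.span {p | ∃ f ∈ L, f ≠ 0 ∧ p = monomial (m.degree f) (1 : K)}

/-- The initial degree of a graded ideal `L ≠ 0`: the `d` with `L_d ≠ 0` and `L_i = 0` for `i < d`.
(The value is `0` for `L = 0`.) -/
def initialDegree (L : Ideal (MvPolynomial (Fin n) K)) : ℕ :=
  sInf {i | ∃ f ∈ L, f ≠ 0 ∧ f.IsHomogeneous i}

/-- The ideal `L'` generated by the monomials of degree `d` in the initial ideal of `L`, where `d`
is the initial degree of `L`. -/
def initialDegreePart (m : MonomialOrder (Fin n)) (L : Ideal (MvPolynomial (Fin n) K)) :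
    Ideal (MvPolynomial (Fin n) K) :=
  Ideal.span {p | ∃ a : Fin n →₀ ℕ, a.degree = initialDegree L ∧
    p = monomial a (1 : K) ∧ p ∈ initialIdeal m L}

end FiberRing

end

/-!
Let `I` be generated by a space `W = I_d` of forms of degree `d`, and let `A` be the set of leading
exponents of `W`. By graded Nakayama `μ(I) = dim W = |A|`, and `μ(I²) = dim (W * W) ≥ |A + A|`,
since the leading exponent of a product is the sum of the leading exponents. Freiman's lemma gives
`|A + A| ≥ r|A| - (r choose 2)`, where `r ≤ |A|` is the rank of the vectors `(1, a)` with `a ∈ A`.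
The ideal `I'` is generated by the monomials `x ^ a` with `a ∈ A`, so its fiber ring is a quotient
of the toric ring `K[x ^ a t : a ∈ A]`, whose dimension is at most its transcendence degree, and
that is at most `r`. Hence `ℓ(I') ≤ r`, and the bound is monotone in `r` as long as `r ≤ |A|`.
-/

section Freiman

open scoped Pointwise

variable {G : Type*} [AddCommMonoid G] [LinearOrder G] [IsOrderedCancelAddMonoid G]

/-- The elements `b` of `insert a A` for which the sum `a + b` does not lie in `A + A`. -/
def freshSummands (a : G) (A : Finset G) : Finset G :=
  {b ∈ insert a A | a + b ∉ A + A}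

theorem card_add_self_add_card_freshSummands_le (a : G) (A : Finset G) :
    (A + A).card + (freshSummands a A).card ≤ (insert a A + insert a A).card := by
  have hdisj : Disjoint (A + A) ((freshSummands a A).image (a + ·)) := by
    rw [Finset.disjoint_right]
    exact Finset.forall_mem_image.2 fun b hb => (Finset.mem_filter.1 hb).2
  have hsub : (A + A) ∪ (freshSummands a A).image (a + ·) ⊆ insert a A + insert a A :=
    Finset.union_subset
      (Finset.add_subset_add (Finset.subset_insert _ _) (Finset.subset_insert _ _))
      (Finset.image_subset_iff.2 fun b hb =>
        Finset.add_mem_add (Finset.mem_insert_self _ _) (Finset.mem_filter.1 hb).1)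
  calc (A + A).card + (freshSummands a A).card
      = ((A + A) ∪ (freshSummands a A).image (a + ·)).card := by
        rw [Finset.card_union_of_disjoint hdisj,
          Finset.card_image_of_injective _ (add_right_injective a)]
    _ ≤ (insert a A + insert a A).card := Finset.card_le_card hsub

theorem self_mem_freshSummands {a : G} {A : Finset G} (ha : ∀ b ∈ A, b < a) :
    a ∈ freshSummands a A := by
  refine Finset.mem_filter.2 ⟨Finset.mem_insert_self _ _, fun h => ?_⟩
  obtain ⟨b, hb, c, hc, hbc⟩ := Finset.mem_add.1 h
  exact (add_lt_add (ha b hb) (ha c hc)).ne hbc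

theorem lt_and_lt_of_add_eq_add {a b c e : G} (hc : c < a) (he : e < a) (h : c + e = a + b) :
    b < c ∧ b < e := by
  constructor <;> by_contra! hle
  · exact (add_lt_add_of_le_of_lt hle he).ne (h.trans (add_comm a b))
  · exact (add_lt_add_of_lt_of_le hc hle).ne h

variable {k V : Type*} [DivisionRing k] [AddCommGroup V] [Module k V] {f : G → V}

-- Descending induction: if `b` is not fresh, then `a + b = c + e` with `b < c, e`, and
-- `f b = f c + f e - f a`.
theorem span_image_freshSummands {a : G} {A : Finset G} (ha : ∀ b ∈ A, b < a)
    (hf : IsAddFreimanHom 2 (insert a A : Finset G) Set.univ f) :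
    Submodule.span k (f '' freshSummands a A) =
      Submodule.span k (f '' (insert a A : Finset G)) := by
  classical
  set W := Submodule.span k (f '' freshSummands a A)
  refine le_antisymm (Submodule.span_mono (Set.image_mono (Finset.coe_subset.2
    (Finset.filter_subset _ _)))) (Submodule.span_le.2 (Set.image_subset_iff.2 ?_))
  by_contra hnot
  obtain ⟨b, hb, hmax⟩ := ((insert a A).filter (f · ∉ W)).exists_max_image id (by
    simpa [Finset.Nonempty, Set.not_subset] using hnot)
  obtain ⟨hbA, hbW⟩ := Finset.mem_filter.1 hb
  have mem_of_gt : ∀ c ∈ A, b < c → f c ∈ W := fun c hc hbc => by_contra fun hcW =>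
    (hmax c (Finset.mem_filter.2 ⟨Finset.mem_insert_of_mem hc, hcW⟩)).not_gt hbc
  have mem_of_fresh : ∀ c ∈ freshSummands a A, f c ∈ W := fun c hc =>
    Submodule.subset_span (Set.mem_image_of_mem f hc)
  have hab : a + b ∈ A + A := by_contra fun hab =>
    hbW (mem_of_fresh b (Finset.mem_filter.2 ⟨hbA, hab⟩))
  obtain ⟨c, hc, e, he, hce⟩ := Finset.mem_add.1 hab
  obtain ⟨hbc, hbe⟩ := lt_and_lt_of_add_eq_add (ha c hc) (ha e he) hce
  have hfb : f b = f c + f e - f a := by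
    rw [hf.add_eq_add (Finset.mem_insert_of_mem hc) (Finset.mem_insert_of_mem he)
      (Finset.mem_insert_self a A) hbA hce, add_sub_cancel_left]
  exact hbW (hfb ▸ W.sub_mem (W.add_mem (mem_of_gt c hc hbc) (mem_of_gt e he hbe))
    (mem_of_fresh a (self_mem_freshSummands ha)))

theorem freshSummands_eq_insert {a : G} {A : Finset G} (ha : ∀ b ∈ A, b < a)
    (hf : IsAddFreimanHom 2 (insert a A : Finset G) Set.univ f)
    (hfa : f a ∉ Submodule.span k (f '' A)) : freshSummands a A = insert a A := by
  refine Finset.filter_true_of_mem fun b hb hab => ?_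
  obtain rfl | hbA := Finset.mem_insert.1 hb
  · exact (Finset.mem_filter.1 (self_mem_freshSummands ha)).2 hab
  · obtain ⟨c, hc, e, he, hce⟩ := Finset.mem_add.1 hab
    have hfa' : f a = f c + f e - f b := by
      rw [hf.add_eq_add (Finset.mem_insert_of_mem hc) (Finset.mem_insert_of_mem he)
        (Finset.mem_insert_self a A) hb hce, add_sub_cancel_right]
    have mem_span : ∀ x ∈ A, f x ∈ Submodule.span k (f '' A) := fun x hx =>
      Submodule.subset_span (Set.mem_image_of_mem f hx)
    exact hfa (hfa' ▸ Submodule.sub_mem _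
      (Submodule.add_mem _ (mem_span c hc) (mem_span e he)) (mem_span b hbA))

theorem finrank_insert_of_notMem_span {s : Set V} (hs : s.Finite) {v : V}
    (hv : v ∉ Submodule.span k s) : (insert v s).finrank k = s.finrank k + 1 := by
  have : FiniteDimensional k (Submodule.span k s) := FiniteDimensional.span_of_finite k hs
  have hv0 : v ≠ 0 := fun h => hv (h ▸ Submodule.zero_mem _)
  have h := Submodule.finrank_sup_add_finrank_inf_eq (Submodule.span k {v}) (Submodule.span k s)
  rw [((Submodule.disjoint_span_singleton' hv0).2 hv).symm.eq_bot, finrank_bot, add_zero,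
    finrank_span_singleton hv0, add_comm 1] at h
  rwa [Set.finrank, Submodule.span_insert]

theorem finrank_image_le_card {α : Type*} (f : α → V) (A : Finset α) :
    (f '' A).finrank k ≤ A.card := by
  classical
  rw [← Finset.coe_image]
  exact (finrank_span_finset_le_card _).trans Finset.card_image_le

/-- **Freiman's lemma**, with the rank of a Freiman homomorphism in place of the dimension. -/
theorem finrank_mul_card_le_card_add_self_add_choose (A : Finset G)
    (hf : IsAddFreimanHom 2 (A : Set G) Set.univ f) :
    (f '' A).finrank k * A.card ≤ (A + A).card + ((f '' A).finrank k).choose 2 := by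
  induction A using Finset.induction_on_max with
  | empty => simp
  | insert a A ha ih =>
    have haA : a ∉ A := fun h => (ha a h).false
    have ih := ih (hf.subset (Finset.coe_subset.2 (Finset.subset_insert a A))
      (Set.mapsTo_univ _ _))
    have hcard := card_add_self_add_card_freshSummands_le a A
    have himage : f '' (insert a A : Finset G) = insert (f a) (f '' A) := by
      rw [Finset.coe_insert, Set.image_insert_eq]
    rw [Finset.card_insert_of_notMem haA]
    by_cases hfa : f a ∈ Submodule.span k (f '' A)
    · have hrank : (f '' (insert a A : Finset G)).finrank k = (f '' A).finrank k := by
        rw [himage, Set.finrank, Submodule.span_insert_eq_span hfa, Set.finrank]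
      have hfresh : (f '' (insert a A : Finset G)).finrank k ≤ (freshSummands a A).card := by
        rw [Set.finrank, ← span_image_freshSummands ha hf]
        exact finrank_image_le_card f _
      rw [hrank] at hfresh ⊢
      linarith
    · have hrank : (f '' (insert a A : Finset G)).finrank k = (f '' A).finrank k + 1 := by
        rw [himage, finrank_insert_of_notMem_span (A.finite_toSet.image f) hfa]
      rw [freshSummands_eq_insert ha hf hfa, Finset.card_insert_of_notMem haA] at hcard
      rw [hrank, Nat.choose_succ_succ' _ 1, Nat.choose_one_right]
      linarith

end Freiman

theorem mul_add_choose_two_le {l r N : ℕ} (hlr : l ≤ r) (hrN : r ≤ N) :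
    l * N + r.choose 2 ≤ r * N + l.choose 2 := by
  induction r, hlr using Nat.le_induction with
  | base => rfl
  | succ r _ ih =>
    rw [Nat.choose_succ_succ' _ 1, Nat.choose_one_right]
    linarith [ih (by lia)]

theorem exists_natCast_eq_of_nonneg_of_le {x : WithBot ℕ∞} {r : ℕ} (h0 : 0 ≤ x) (hr : x ≤ r) :
    ∃ l : ℕ, x = l ∧ l ≤ r := by
  lift x to ℕ∞ using fun h => by simp [h] at h0
  lift x to ℕ using ((WithBot.coe_le_coe.1 hr).trans_lt (ENat.natCast_lt_top r)).ne
  exact ⟨x, rfl, mod_cast hr⟩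

section Dimension

theorem linearIndependent_rat_of_nat {ι V : Type*} [AddCommGroup V] [Module ℚ V] {v : ι → V}
    (h : LinearIndependent ℕ v) : LinearIndependent ℚ v := by
  rw [← LinearIndependent.iff_fractionRing ℤ ℚ, linearIndependent_iff']
  intro s g hg i hi
  have hpos_neg : ∑ j ∈ s, (g j).toNat • v j = ∑ j ∈ s, (-g j).toNat • v j := by
    rw [← sub_eq_zero, ← Finset.sum_sub_distrib, ← hg]
    refine Finset.sum_congr rfl fun j _ => ?_
    rw [← natCast_zsmul, ← natCast_zsmul, ← sub_smul, Int.toNat_sub_toNat_neg]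
  have := linearIndependent_iff'ₛ.1 h s _ _ hpos_neg i hi
  lia

theorem ringKrullDim_le_of_isIntegral {R S : Type*} [CommRing R] [CommRing S] [Algebra R S]
    [Algebra.IsIntegral R S] : ringKrullDim S ≤ ringKrullDim R :=
  Order.krullDim_le_of_strictMono (PrimeSpectrum.comap (algebraMap R S)) fun _ _ hpq =>
    Ideal.IsIntegral.comap_lt_comap hpq

theorem ringKrullDim_le_trdeg (K F : Type*) [Field K] [CommRing F] [Algebra K F]
    [Algebra.FiniteType K F] : ringKrullDim F ≤ (Algebra.trdeg K F).toNat := by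
  nontriviality F
  obtain ⟨s, g, hginj, hgint⟩ := exists_integral_inj_algHom_of_fg K F
  algebraize [g.toRingHom]
  have : Algebra.IsIntegral (MvPolynomial (Fin s) K) F := ⟨hgint⟩
  have hs : s ≤ (Algebra.trdeg K F).toNat := by
    have h := lift_trdeg_le_of_injective g hginj
    rw [MvPolynomial.trdeg_of_isDomain, Cardinal.mk_fin, Cardinal.lift_lift,
      Cardinal.lift_natCast] at h
    have := Cardinal.toNat_le_toNat h (Cardinal.lift_lt_aleph0.2 trdeg_lt_aleph0_of_finiteType)
    simpa using this
  calc ringKrullDim F ≤ ringKrullDim (MvPolynomial (Fin s) K) := ringKrullDim_le_of_isIntegral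
    _ = s := by
      rw [MvPolynomial.ringKrullDim_of_isNoetherianRing, ringKrullDim_eq_zero_of_field, zero_add,
        Nat.card_fin]
    _ ≤ (Algebra.trdeg K F).toNat := mod_cast hs

theorem linearIndependent_nat_of_algebraicIndependent {R M B ι : Type*} [CommRing R] [Nontrivial R]
    [AddCommMonoid M] [CommRing B] [Algebra R B] (φ : Multiplicative M →* B) {s : ι → M}
    (hs : AlgebraicIndependent R fun i => φ (.ofAdd (s i))) : LinearIndependent ℕ s := by
  intro u v huv
  have aeval_eq : ∀ w : ι →₀ ℕ, aeval (fun i => φ (.ofAdd (s i))) (monomial w (1 : R)) =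
      φ (.ofAdd (Finsupp.linearCombination ℕ s w)) := fun w => by
    simp [aeval_monomial, Finsupp.linearCombination_apply, Finsupp.prod, Finsupp.sum, ofAdd_sum,
      ofAdd_nsmul]
  exact monomial_left_injective one_ne_zero (hs (by rw [aeval_eq, aeval_eq, huv]))

theorem exists_isTranscendenceBasis_subset_adjoin (K : Type*) {B : Type*} [Field K] [CommRing B]
    [IsDomain B] [Algebra K B] (s : Set B) :
    ∃ t ⊆ ((↑) ⁻¹' s : Set (Algebra.adjoin K s)),
      IsTranscendenceBasis K ((↑) : t → Algebra.adjoin K s) := by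
  have : Algebra.IsAlgebraic (Algebra.adjoin K ((↑) ⁻¹' s : Set (Algebra.adjoin K s)))
      (Algebra.adjoin K s) := by
    rw [Algebra.adjoin_adjoin_coe_preimage]
    exact ⟨fun x => isAlgebraic_algebraMap (⟨x, trivial⟩ : (⊤ : Subalgebra K _))⟩
  exact exists_isTranscendenceBasis_subset _

theorem ringKrullDim_adjoin_image_le_finrank {K M B V : Type*} [Field K] [AddCommMonoid M]
    [CommRing B] [IsDomain B] [Algebra K B] [AddCommGroup V] [Module ℚ V]
    (φ : Multiplicative M →* B) {j : M →+ V} (hj : Function.Injective j) {S : Set M}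
    (hS : S.Finite) :
    ringKrullDim (Algebra.adjoin K ((fun a => φ (.ofAdd a)) '' S)) ≤ (j '' S).finrank ℚ := by
  set s := (fun a => φ (.ofAdd a)) '' S
  obtain ⟨t, hts, ht⟩ := exists_isTranscendenceBasis_subset_adjoin K s
  have : Algebra.FiniteType K (Algebra.adjoin K s) :=
    (Subalgebra.fg_iff_finiteType _).1 (Subalgebra.fg_def.2 ⟨s, hS.image _, rfl⟩)
  choose e heS he using fun a : t => hts a.2
  have hli : LinearIndependent ℚ (fun a => j (e a)) := by
    refine linearIndependent_rat_of_nat (LinearIndependent.map_injOn (f := j.toNatLinearMap)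
      (linearIndependent_nat_of_algebraicIndependent (R := K) φ ?_) hj.injOn)
    simpa only [he] using! ht.1.map' (f := (Algebra.adjoin K s).val) Subtype.val_injective
  have : Fintype t := (((hS.image _).preimage Subtype.val_injective.injOn).subset hts).fintype
  have : FiniteDimensional ℚ (Submodule.span ℚ (j '' S)) :=
    FiniteDimensional.span_of_finite ℚ (hS.image j)
  have hcard : Fintype.card t ≤ (j '' S).finrank ℚ := by
    rw [← finrank_span_eq_card hli]
    exact Submodule.finrank_mono (Submodule.span_mono (Set.range_subset_iff.2 fun a =>
      Set.mem_image_of_mem j (heS a)))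
  calc ringKrullDim (Algebra.adjoin K s) ≤ (Algebra.trdeg K (Algebra.adjoin K s)).toNat :=
        ringKrullDim_le_trdeg K _
    _ = Fintype.card t := by rw [← ht.cardinalMk_eq_trdeg, Cardinal.mk_toNat_eq_card]
    _ ≤ (j '' S).finrank ℚ := mod_cast hcard

end Dimension

section InitialForms

variable {σ R : Type*} [CommRing R] {d : ℕ} {f : MvPolynomial σ R} {G s : Set (MvPolynomial σ R)}

theorem sub_C_constantCoeff_mem_idealOfVars (p : MvPolynomial σ R) :
    p - C (constantCoeff p) ∈ idealOfVars σ R := by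
  rw [← pow_one (idealOfVars σ R), mem_pow_idealOfVars_iff']
  intro a ha
  rw [Nat.lt_one_iff, Finsupp.degree_eq_zero_iff] at ha
  rw [ha, coeff_sub, coeff_zero_C, constantCoeff_eq, sub_self]

theorem homogeneousComponent_eq_zero_of_mem_pow_idealOfVars {k : ℕ}
    (hf : f ∈ idealOfVars σ R ^ k) (hdk : d < k) : homogeneousComponent d f = 0 :=
  homogeneousComponent_eq_zero' d f fun a ha =>
    (hdk.trans_le ((mem_pow_idealOfVars_iff k f).1 hf a ha)).ne'

theorem homogeneousComponent_mul_of_mem_pow_idealOfVars (hf : f ∈ idealOfVars σ R ^ d)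
    (c : MvPolynomial σ R) :
    homogeneousComponent d (c * f) = constantCoeff c • homogeneousComponent d f := by
  have hmem : (c - C (constantCoeff c)) * f ∈ idealOfVars σ R ^ (d + 1) := by
    rw [pow_succ']
    exact Ideal.mul_mem_mul (sub_C_constantCoeff_mem_idealOfVars c) hf
  rw [← sub_eq_zero, smul_eq_C_mul, ← homogeneousComponent_C_mul, ← map_sub, ← sub_mul]
  exact homogeneousComponent_eq_zero_of_mem_pow_idealOfVars hmem d.lt_succ_self

theorem homogeneousComponent_mem_span_image (hs : s ⊆ (idealOfVars σ R ^ d : Ideal _))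
    (hf : f ∈ Ideal.span s) :
    homogeneousComponent d f ∈ Submodule.span R (homogeneousComponent d '' s) := by
  induction hf using Submodule.span_induction with
  | mem f hf => exact Submodule.subset_span (Set.mem_image_of_mem _ hf)
  | zero => rw [map_zero]; exact Submodule.zero_mem _
  | add f g _ _ hf hg => rw [map_add]; exact Submodule.add_mem _ hf hg
  | smul c f hf ih =>
    rw [smul_eq_mul, homogeneousComponent_mul_of_mem_pow_idealOfVars (Ideal.span_le.2 hs hf)]
    exact Submodule.smul_mem _ _ ih

theorem span_le_pow_idealOfVars (hG : ∀ g ∈ G, g.IsHomogeneous d) :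
    Ideal.span G ≤ idealOfVars σ R ^ d :=
  Ideal.span_le.2 fun g hg => (mem_pow_idealOfVars_iff' d g).2 fun _ ha =>
    (hG g hg).coeff_eq_zero ha.ne

theorem image_homogeneousComponent_eq_self (hG : ∀ g ∈ G, g.IsHomogeneous d) :
    homogeneousComponent d '' G = G := by
  rw [Set.image_congr fun g hg => homogeneousComponent_eq_self (hG g hg), Set.image_id']

theorem homogeneousComponent_mem_span (hG : ∀ g ∈ G, g.IsHomogeneous d)
    (hf : f ∈ Ideal.span G) : homogeneousComponent d f ∈ Submodule.span R G := by
  rw [← image_homogeneousComponent_eq_self hG]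
  exact homogeneousComponent_mem_span_image (Ideal.span_le.1 (span_le_pow_idealOfVars hG)) hf

theorem span_image_homogeneousComponent_eq (hG : ∀ g ∈ G, g.IsHomogeneous d)
    (hs : Ideal.span s = Ideal.span G) :
    Submodule.span R (homogeneousComponent d '' s) = Submodule.span R G := by
  have hsG : s ⊆ Ideal.span G := hs ▸ Ideal.subset_span
  refine le_antisymm (Submodule.span_le.2 ?_) (Submodule.span_le.2 fun g hg => ?_)
  · exact Set.image_subset_iff.2 fun f hf => homogeneousComponent_mem_span hG (hsG hf)
  · rw [← homogeneousComponent_eq_self (hG g hg)]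
    exact homogeneousComponent_mem_span_image (hsG.trans (span_le_pow_idealOfVars hG))
      (hs ▸ Ideal.subset_span hg)

end InitialForms

section MinimalGenerators

variable {K : Type*} [Field K]

theorem spanFinrank_ideal_span_le_finrank {R : Type*} [CommRing R] [Algebra K R] (G : Set R)
    [FiniteDimensional K (Submodule.span K G)] : (Ideal.span G).spanFinrank ≤ G.finrank K := by
  obtain ⟨b, -, hb, -⟩ := Submodule.exists_fun_fin_finrank_span_eq K G
  have hspan : Ideal.span G = Ideal.span (Set.range b) := by
    rw [Ideal.span, ← Submodule.span_span_of_tower K R G]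
    exact (congrArg (fun W : Submodule K R => Submodule.span R (W : Set R)) hb).symm.trans
      (Submodule.span_span_of_tower K R _)
  calc (Ideal.span G).spanFinrank ≤ (Set.range b).ncard := by
        rw [hspan]
        exact Submodule.spanFinrank_span_le_ncard_of_finite (Set.finite_range b)
    _ ≤ G.finrank K := by
        rw [← Nat.card_coe_set_eq]
        exact (Finite.card_range_le b).trans_eq (Nat.card_fin _)

variable {σ : Type*} [Finite σ] {d : ℕ} {G : Set (MvPolynomial σ K)}

theorem finiteDimensional_span_of_isHomogeneous (hG : ∀ g ∈ G, g.IsHomogeneous d) :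
    FiniteDimensional K (Submodule.span K G) := by
  obtain ⟨s, hs⟩ := IsNoetherian.noetherian (Ideal.span G)
  rw [← span_image_homogeneousComponent_eq hG hs]
  exact FiniteDimensional.span_of_finite K (s.finite_toSet.image _)

theorem spanFinrank_ideal_span_eq_finrank (hG : ∀ g ∈ G, g.IsHomogeneous d) :
    (Ideal.span G).spanFinrank = G.finrank K := by
  have := finiteDimensional_span_of_isHomogeneous hG
  refine (spanFinrank_ideal_span_le_finrank G).antisymm ?_
  obtain ⟨s, hcard, hs⟩ := Submodule.FG.exists_span_finset_card_eq_spanFinrank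
    (IsNoetherian.noetherian (Ideal.span G))
  rw [← hcard, Set.finrank, ← span_image_homogeneousComponent_eq hG hs]
  exact finrank_image_le_card _ s

end MinimalGenerators

section LeadingExponents

variable {σ : Type*} {K : Type*} [Field K] (m : MonomialOrder σ)

/-- The leading exponents of the nonzero elements of a space `W` of polynomials. -/
def leadingExponents (W : Submodule K (MvPolynomial σ K)) : Set (σ →₀ ℕ) :=
  {a | ∃ f ∈ W, f ≠ 0 ∧ m.degree f = a}

variable {m} {V W : Submodule K (MvPolynomial σ K)}

open scoped Pointwise in
theorem leadingExponents_add_subset :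
    leadingExponents m V + leadingExponents m W ⊆ leadingExponents m (V * W) := by
  rintro _ ⟨_, ⟨f, hf, hf0, rfl⟩, _, ⟨g, hg, hg0, rfl⟩, rfl⟩
  exact ⟨f * g, Submodule.mul_mem_mul hf hg, mul_ne_zero hf0 hg0, m.degree_mul hf0 hg0⟩

theorem linearIndependent_of_injective_degree {ι : Type*} {v : ι → MvPolynomial σ K}
    (h0 : ∀ i, v i ≠ 0) (hinj : Function.Injective fun i => m.degree (v i)) :
    LinearIndependent K v := by
  classical
  rw [linearIndependent_iff']
  intro s g hg
  by_contra! hne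
  obtain ⟨i, hi, hgi⟩ := hne
  obtain ⟨j, hj, hmax⟩ := (s.filter fun i => g i ≠ 0).exists_max_image
    (fun i => m.toSyn (m.degree (v i))) ⟨i, Finset.mem_filter.2 ⟨hi, hgi⟩⟩
  obtain ⟨hjs, hgj⟩ := Finset.mem_filter.1 hj
  have coeff_eq_zero : ∀ k ∈ s, k ≠ j → (g k • v k).coeff (m.degree (v j)) = 0 := by
    intro k hk hkj
    rw [coeff_smul]
    obtain hgk | hgk := eq_or_ne (g k) 0
    · rw [hgk, zero_smul]
    · have hlt : m.toSyn (m.degree (v k)) < m.toSyn (m.degree (v j)) :=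
        (hmax k (Finset.mem_filter.2 ⟨hk, hgk⟩)).lt_of_ne fun h =>
          hkj (hinj (m.toSyn.injective h))
      rw [m.coeff_eq_zero_of_lt hlt, smul_zero]
  have hsum := congrArg (coeff (m.degree (v j))) hg
  rw [coeff_sum, Finset.sum_eq_single j coeff_eq_zero (absurd hjs), coeff_smul, coeff_zero,
    smul_eq_mul] at hsum
  exact mul_ne_zero hgj (m.coeff_degree_ne_zero_iff.2 (h0 j)) hsum

open scoped MonomialOrder in
theorem exists_toSyn_degree_sub_smul_lt {f g : MvPolynomial σ K} (hg : g ≠ 0)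
    (hfg : m.degree f = m.degree g) :
    ∃ c : K, f - c • g = 0 ∨ m.degree (f - c • g) ≺[m] m.degree f := by
  set c := m.leadingCoeff f / m.leadingCoeff g
  refine ⟨c, or_iff_not_imp_left.2 fun hsub => lt_of_le_of_ne ?_ fun heq => ?_⟩
  · exact m.degree_sub_le.trans (sup_le le_rfl (m.degree_smul_le.trans_eq (by rw [hfg])))
  · refine m.coeff_degree_ne_zero_iff.2 hsub ?_
    rw [m.toSyn.injective heq, coeff_sub, coeff_smul]
    nth_rw 2 [hfg]
    exact sub_eq_zero.2 (div_mul_cancel₀ _ (m.leadingCoeff_ne_zero_iff.2 hg)).symm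

theorem span_range_eq_of_leadingExponents {ι : Type*} {v : ι → MvPolynomial σ K}
    (hvW : ∀ i, v i ∈ W) (h0 : ∀ i, v i ≠ 0)
    (hv : leadingExponents m W ⊆ Set.range fun i => m.degree (v i)) :
    Submodule.span K (Set.range v) = W := by
  refine le_antisymm (Submodule.span_le.2 (Set.range_subset_iff.2 hvW)) fun f hf => ?_
  induction h : m.toSyn (m.degree f) using WellFoundedLT.induction generalizing f with
  | ind k ih =>
    obtain rfl | hf0 := eq_or_ne f 0
    · exact Submodule.zero_mem _
    obtain ⟨i, hi⟩ := hv ⟨f, hf, hf0, rfl⟩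
    have hvi : v i ∈ Submodule.span K (Set.range v) :=
      Submodule.subset_span (Set.mem_range_self i)
    obtain ⟨c, hc⟩ := exists_toSyn_degree_sub_smul_lt (h0 i) hi.symm
    rw [← sub_add_cancel f (c • v i)]
    refine Submodule.add_mem _ ?_ (Submodule.smul_mem _ c hvi)
    obtain hzero | hlt := hc
    · exact hzero ▸ Submodule.zero_mem _
    · exact ih _ (h ▸ hlt) _ (W.sub_mem hf (W.smul_mem c (hvW i))) rfl

theorem nonempty_basis_leadingExponents (m : MonomialOrder σ) (W : Submodule K (MvPolynomial σ K)) :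
    Nonempty (Module.Basis (leadingExponents m W) K W) := by
  choose v hvW h0 hdeg using fun a : leadingExponents m W => a.2
  have hli : LinearIndependent K v :=
    linearIndependent_of_injective_degree (m := m) h0 <| by
      simpa only [hdeg] using Subtype.val_injective
  have hspan : Submodule.span K (Set.range v) = W :=
    span_range_eq_of_leadingExponents hvW h0 fun a ha => ⟨⟨a, ha⟩, hdeg _⟩
  exact ⟨(Module.Basis.span hli).map (LinearEquiv.ofEq _ _ hspan)⟩

theorem ncard_leadingExponents (m : MonomialOrder σ) (W : Submodule K (MvPolynomial σ K)) :
    (leadingExponents m W).ncard = Module.finrank K W := by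
  obtain ⟨b⟩ := nonempty_basis_leadingExponents m W
  rw [Module.finrank_eq_nat_card_basis b, Nat.card_coe_set_eq]

theorem finite_leadingExponents (m : MonomialOrder σ) (W : Submodule K (MvPolynomial σ K))
    [FiniteDimensional K W] : (leadingExponents m W).Finite := by
  obtain ⟨b⟩ := nonempty_basis_leadingExponents m W
  exact Set.finite_coe_iff.1 (Module.Finite.finite_basis b)

end LeadingExponents

section Square

open scoped Pointwise

variable {σ K : Type*} [Field K] [Finite σ] (m : MonomialOrder σ) {d : ℕ}
  {G : Set (MvPolynomial σ K)}

theorem spanFinrank_ideal_span_eq_ncard_leadingExponents (hG : ∀ g ∈ G, g.IsHomogeneous d) :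
    (Ideal.span G).spanFinrank = (leadingExponents m (Submodule.span K G)).ncard := by
  rw [spanFinrank_ideal_span_eq_finrank hG, ncard_leadingExponents, Set.finrank]

theorem ncard_leadingExponents_add_le_spanFinrank_sq (hG : ∀ g ∈ G, g.IsHomogeneous d) :
    (leadingExponents m (Submodule.span K G) + leadingExponents m (Submodule.span K G)).ncard ≤
      (Ideal.span G ^ 2).spanFinrank := by
  have hGG : ∀ f ∈ G * G, f.IsHomogeneous (d + d) := by
    rintro _ ⟨f, hf, g, hg, rfl⟩
    exact (hG f hf).mul (hG g hg)
  have := finiteDimensional_span_of_isHomogeneous hGG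
  rw [pow_two, Ideal.span_mul_span', spanFinrank_ideal_span_eq_ncard_leadingExponents m hGG]
  refine Set.ncard_le_ncard ?_ (finite_leadingExponents m _)
  rw [← Submodule.span_mul_span]
  exact leadingExponents_add_subset

end Square

section InitialDegree

variable {σ K : Type*} [Field K] {m : MonomialOrder σ} {d : ℕ} {f : MvPolynomial σ K}
  {G : Set (MvPolynomial σ K)}

theorem degree_degree_eq_of_isHomogeneous (hf : f.IsHomogeneous d) (hf0 : f ≠ 0) :
    (m.degree f).degree = d := by
  by_contra h
  exact m.coeff_degree_ne_zero_iff.2 hf0 (hf.coeff_eq_zero h)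

theorem isHomogeneous_of_mem_span (hG : ∀ g ∈ G, g.IsHomogeneous d)
    (hf : f ∈ Submodule.span K G) : f.IsHomogeneous d :=
  Submodule.span_le (p := homogeneousSubmodule σ K d).2 hG hf

theorem le_degree_degree_of_mem_ideal_span (hG : ∀ g ∈ G, g.IsHomogeneous d)
    (hf : f ∈ Ideal.span G) (hf0 : f ≠ 0) : d ≤ (m.degree f).degree :=
  (mem_pow_idealOfVars_iff d f).1 (span_le_pow_idealOfVars hG hf) _ (m.degree_mem_support hf0)

theorem homogeneousComponent_degree_degree_ne_zero (hf0 : f ≠ 0) :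
    homogeneousComponent (m.degree f).degree f ≠ 0 := by
  refine ne_zero_iff.2 ⟨m.degree f, ?_⟩
  rw [coeff_homogeneousComponent, if_pos rfl]
  exact m.coeff_degree_ne_zero_iff.2 hf0

theorem degree_homogeneousComponent_degree_degree (hf0 : f ≠ 0) :
    m.degree (homogeneousComponent (m.degree f).degree f) = m.degree f := by
  refine m.toSyn.injective (le_antisymm (m.degree_le_iff.2 fun b hb => m.le_degree ?_)
    (m.le_degree ?_))
  · rw [mem_support_iff, coeff_homogeneousComponent] at hb
    exact mem_support_iff.2 (ite_ne_right_iff.1 hb).2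
  · rw [mem_support_iff, coeff_homogeneousComponent, if_pos rfl]
    exact m.coeff_degree_ne_zero_iff.2 hf0

end InitialDegree

namespace FiberRing

section InitialIdeal

variable {K : Type*} [Field K] {n : ℕ} {m : MonomialOrder (Fin n)} {d : ℕ}
  {G : Set (MvPolynomial (Fin n) K)}

theorem monomial_mem_initialIdeal_iff {L : Ideal (MvPolynomial (Fin n) K)} {a : Fin n →₀ ℕ} :
    monomial a 1 ∈ initialIdeal m L ↔ ∃ f ∈ L, f ≠ 0 ∧ m.degree f ≤ a := by
  classical
  have himage : {p | ∃ f ∈ L, f ≠ 0 ∧ p = monomial (m.degree f) (1 : K)} =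
      (monomial · 1) '' {b | ∃ f ∈ L, f ≠ 0 ∧ m.degree f = b} := by
    ext p
    simp only [Set.mem_image, Set.mem_ofPred_eq]
    grind
  rw [initialIdeal, himage, mem_ideal_span_monomial_image]
  simp only [support_monomial, one_ne_zero, if_false, Finset.mem_singleton, forall_eq,
    Set.mem_ofPred_eq]
  grind

theorem initialDegree_span (hG : ∀ g ∈ G, g.IsHomogeneous d) (hne : Ideal.span G ≠ ⊥) :
    initialDegree (Ideal.span G) = d := by
  obtain ⟨g, hg, hg0⟩ : ∃ g ∈ G, g ≠ 0 := by
    simpa only [ne_eq, Ideal.span_eq_bot, not_forall, exists_prop] using hne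
  refine IsLeast.csInf_eq ⟨⟨g, Ideal.subset_span hg, hg0, hG g hg⟩, ?_⟩
  rintro i ⟨f, hf, hf0, hfi⟩
  rw [← degree_degree_eq_of_isHomogeneous (m := MonomialOrder.lex) hfi hf0]
  exact le_degree_degree_of_mem_ideal_span hG hf hf0

theorem mem_leadingExponents_span_iff (hG : ∀ g ∈ G, g.IsHomogeneous d) {a : Fin n →₀ ℕ} :
    a ∈ leadingExponents m (Submodule.span K G) ↔
      a.degree = d ∧ monomial a 1 ∈ initialIdeal m (Ideal.span G) := by
  rw [monomial_mem_initialIdeal_iff]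
  constructor
  · rintro ⟨f, hf, hf0, rfl⟩
    exact ⟨degree_degree_eq_of_isHomogeneous (isHomogeneous_of_mem_span hG hf) hf0,
      f, Submodule.span_subset_span K _ G hf, hf0, le_rfl⟩
  · rintro ⟨rfl, f, hf, hf0, hle⟩
    obtain rfl : m.degree f = a := by
      obtain ⟨b, rfl⟩ := exists_add_of_le hle
      have hdeg := le_degree_degree_of_mem_ideal_span (m := m) hG hf hf0
      rw [map_add, add_le_iff_nonpos_right, nonpos_iff_eq_zero, Finsupp.degree_eq_zero_iff] at hdeg
      rw [hdeg, add_zero]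
    exact ⟨_, homogeneousComponent_mem_span hG hf, homogeneousComponent_degree_degree_ne_zero hf0,
      degree_homogeneousComponent_degree_degree hf0⟩

theorem initialDegreePart_span (m : MonomialOrder (Fin n)) (hG : ∀ g ∈ G, g.IsHomogeneous d) :
    initialDegreePart m (Ideal.span G) =
      Ideal.span ((monomial · 1) '' leadingExponents m (Submodule.span K G)) := by
  rw [initialDegreePart]
  congr 1
  ext p
  have hdeg : ∀ a, monomial a 1 ∈ initialIdeal m (Ideal.span G) →
      initialDegree (Ideal.span G) = d := fun a ha => by
    obtain ⟨f, hf, hf0, -⟩ := monomial_mem_initialIdeal_iff.1 ha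
    exact initialDegree_span hG (Submodule.ne_bot_iff _ |>.2 ⟨f, hf, hf0⟩)
  constructor
  · rintro ⟨a, had, rfl, ha⟩
    exact ⟨a, (mem_leadingExponents_span_iff hG).2 ⟨had.trans (hdeg a ha), ha⟩, rfl⟩
  · rintro ⟨a, ha, rfl⟩
    obtain ⟨had, ha⟩ := (mem_leadingExponents_span_iff hG).1 ha
    exact ⟨a, had.trans (hdeg a ha).symm, rfl, ha⟩

theorem monomial_mem_of_mem_support {I : Ideal (MvPolynomial (Fin n) K)} (hI : IsMonomialIdeal I)
    {f : MvPolynomial (Fin n) K} (hf : f ∈ I) {a : Fin n →₀ ℕ} (ha : a ∈ f.support) :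
    monomial a 1 ∈ I := by
  classical
  obtain ⟨B, rfl⟩ := hI
  rw [mem_ideal_span_monomial_image] at hf ⊢
  rw [support_monomial, if_neg one_ne_zero]
  exact fun b hb => Finset.mem_singleton.1 hb ▸ hf a ha

theorem initialDegreePart_eq_self (m : MonomialOrder (Fin n)) {I : Ideal (MvPolynomial (Fin n) K)}
    (hI : IsEquigenerated I) (hmon : IsMonomialIdeal I) : initialDegreePart m I = I := by
  obtain ⟨d, G, hG, rfl⟩ := hI
  rw [initialDegreePart_span m hG]
  refine le_antisymm (Ideal.span_le.2 ?_) (Ideal.span_le.2 fun g hg => ?_)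
  · rintro _ ⟨_, ⟨f, hf, hf0, rfl⟩, rfl⟩
    exact monomial_mem_of_mem_support hmon (Submodule.span_subset_span K _ G hf)
      (m.degree_mem_support hf0)
  · classical
    refine mem_ideal_span_monomial_image.2 fun a ha => ⟨a, ?_, le_rfl⟩
    refine (mem_leadingExponents_span_iff hG).2 ⟨?_, monomial_mem_initialIdeal_iff.2
      ⟨monomial a 1, monomial_mem_of_mem_support hmon (Ideal.subset_span hg) ha,
        monomial_eq_zero.not.2 one_ne_zero, ?_⟩⟩
    · exact by_contra fun h => mem_support_iff.1 ha ((hG g hg).coeff_eq_zero h)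
    · rw [m.degree_monomial, if_neg one_ne_zero]

end InitialIdeal

end FiberRing

section ToricRing

variable (R : Type*) [CommRing R] {σ : Type*}

/-- The monoid homomorphism `(k, a) ↦ x ^ a * t ^ k` into the polynomial ring in `t`. -/
noncomputable def gradedMonomial :
    Multiplicative (ℕ × (σ →₀ ℕ)) →* Polynomial (MvPolynomial σ R) where
  toFun p := Polynomial.monomial p.toAdd.1 (monomial p.toAdd.2 1)
  map_one' := rfl
  map_mul' p q := by
    rw [Polynomial.monomial_mul_monomial, monomial_mul, one_mul]
    rfl

variable (σ) in
/-- The coordinatewise inclusion of the exponents `(k, a)` of `t` and `x` into a rational vector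
space. -/
noncomputable def rationalExponent : ℕ × (σ →₀ ℕ) →+ ℚ × (σ →₀ ℚ) :=
  (Nat.castAddMonoidHom ℚ).prodMap (Finsupp.mapRange.addMonoidHom (Nat.castAddMonoidHom ℚ))

theorem rationalExponent_injective : Function.Injective (rationalExponent σ) :=
  Function.Injective.prodMap Nat.cast_injective
    (Finsupp.mapRange_injective _ Nat.cast_zero Nat.cast_injective)

/-- The rank of the cone over `A`, spanned by the vectors `(1, a)` with `a ∈ A`. -/
noncomputable def coneRank (A : Set (σ →₀ ℕ)) : ℕ :=
  ((fun a => rationalExponent σ (1, a)) '' A).finrank ℚ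

theorem ringKrullDim_adjoin_monomial_le_coneRank (K : Type*) [Field K] {A : Set (σ →₀ ℕ)}
    (hA : A.Finite) :
    ringKrullDim (Algebra.adjoin K ((fun a => Polynomial.monomial 1 (monomial a (1 : K))) '' A)) ≤
      coneRank A := by
  have h := ringKrullDim_adjoin_image_le_finrank (K := K) (gradedMonomial K)
    (rationalExponent_injective (σ := σ)) (hA.image (Prod.mk 1))
  rwa [Set.image_image, Set.image_image] at h

open scoped Pointwise in
theorem coneRank_mul_ncard_le_ncard_add_self_add_choose (m : MonomialOrder σ) {A : Set (σ →₀ ℕ)}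
    (hA : A.Finite) :
    coneRank A * A.ncard ≤ (A + A).ncard + (coneRank A).choose 2 := by
  classical
  lift A to Finset (σ →₀ ℕ) using hA
  set f : m.syn → ℚ × (σ →₀ ℚ) := fun x => rationalExponent σ (1, m.toSyn.symm x)
  have hf : IsAddFreimanHom 2 (A.image m.toSyn : Set m.syn) Set.univ f := by
    refine isAddFreimanHom_two.2 ⟨Set.mapsTo_univ _ _, fun a _ b _ c _ e _ h => ?_⟩
    simp only [f, ← map_add, Prod.mk_add_mk, h]
  have himage : f '' (A.image m.toSyn) = (fun a => rationalExponent σ (1, a)) '' A := by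
    rw [Finset.coe_image, Set.image_image]
    simp only [f, AddEquiv.symm_apply_apply]
  have hfreiman := finrank_mul_card_le_card_add_self_add_choose (k := ℚ) _ hf
  rw [himage, ← Finset.image_add, Finset.card_image_of_injective _ m.toSyn.injective,
    Finset.card_image_of_injective _ m.toSyn.injective] at hfreiman
  rwa [← Finset.coe_add, Set.ncard_coe_finset, Set.ncard_coe_finset]

theorem coneRank_le_ncard {A : Set (σ →₀ ℕ)} (hA : A.Finite) : coneRank A ≤ A.ncard := by
  lift A to Finset (σ →₀ ℕ) using hA
  rw [Set.ncard_coe_finset]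
  exact finrank_image_le_card _ A

end ToricRing

theorem adjoin_eq_top_of_range_algebraMap_le {K S F : Type*} [CommRing K] [CommRing S] [Ring F]
    [Algebra K F] [Algebra S F] {t : Set F} (h : (algebraMap S F).range ≤ (algebraMap K F).range)
    (ht : Algebra.adjoin S t = ⊤) : Algebra.adjoin K t = ⊤ := by
  refine eq_top_iff.2 fun x _ => ?_
  induction (ht ▸ Algebra.mem_top : x ∈ Algebra.adjoin S t) using Algebra.adjoin_induction with
  | mem x hx => exact Algebra.subset_adjoin hx
  | algebraMap p =>
    obtain ⟨c, hc⟩ := h ⟨p, rfl⟩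
    exact hc ▸ Subalgebra.algebraMap_mem _ c
  | add x y _ _ hx hy => exact add_mem (hx trivial) (hy trivial)
  | mul x y _ _ hx hy => exact mul_mem (hx trivial) (hy trivial)

theorem adjoin_monomial_image_eq_reesAlgebra {R : Type*} [CommRing R] (G : Set R) :
    Algebra.adjoin R (Polynomial.monomial 1 '' G) = reesAlgebra (Ideal.span G) := by
  rw [← adjoin_monomial_eq_reesAlgebra, Ideal.span, Submodule.map_span, Algebra.adjoin_span]

theorem adjoin_preimage_monomial_image_eq_top {R : Type*} [CommRing R] (G : Set R) :
    Algebra.adjoin R ((↑) ⁻¹' (Polynomial.monomial 1 '' G) : Set (reesAlgebra (Ideal.span G))) =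
      ⊤ := by
  rw [← adjoin_monomial_image_eq_reesAlgebra]
  exact Algebra.adjoin_adjoin_coe_preimage

namespace FiberRing

section Fiber

variable {K : Type*} [Field K] {n : ℕ}

instance nontrivial_fiber (I : Ideal (MvPolynomial (Fin n) K)) : Nontrivial (Fiber I) := by
  refine Ideal.Quotient.nontrivial_iff.2 fun htop => ?_
  let φ : reesAlgebra I →+* K := (constantCoeff.comp
    (Polynomial.constantCoeff (R := MvPolynomial (Fin n) K))).comp (reesAlgebra I).val.toRingHom
  have hker : (gradedMaximalIdeal K n).map
      (algebraMap (MvPolynomial (Fin n) K) (reesAlgebra I)) ≤ RingHom.ker φ := by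
    rw [gradedMaximalIdeal, Ideal.map_span, Ideal.span_le]
    rintro _ ⟨_, ⟨i, rfl⟩, rfl⟩
    simp [φ, RingHom.mem_ker]
  exact RingHom.ker_ne_top φ (top_le_iff.1 (htop ▸ hker))

theorem algebraMap_fiber_eq (I : Ideal (MvPolynomial (Fin n) K)) (p : MvPolynomial (Fin n) K) :
    algebraMap (MvPolynomial (Fin n) K) (Fiber I) p = algebraMap K (Fiber I) (constantCoeff p) := by
  rw [IsScalarTower.algebraMap_apply K (MvPolynomial (Fin n) K) (Fiber I), ← sub_eq_zero,
    ← map_sub]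
  exact Ideal.Quotient.eq_zero_iff_mem.2
    (Ideal.mem_map_of_mem _ (sub_C_constantCoeff_mem_idealOfVars p))

theorem ringKrullDim_fiber_le (G : Set (MvPolynomial (Fin n) K)) :
    ringKrullDim (Fiber (Ideal.span G)) ≤
      ringKrullDim (Algebra.adjoin K (Polynomial.monomial 1 '' G)) := by
  set R := reesAlgebra (Ideal.span G)
  set s : Set R := (↑) ⁻¹' (Polynomial.monomial 1 '' G)
  set mk := Ideal.Quotient.mkₐ (MvPolynomial (Fin n) K)
    ((gradedMaximalIdeal K n).map (algebraMap (MvPolynomial (Fin n) K) R))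
  have hs : R.val '' s = Polynomial.monomial 1 '' G :=
    (Subtype.image_preimage_coe _ _).trans (Set.inter_eq_right.2
      (Algebra.subset_adjoin.trans (adjoin_monomial_image_eq_reesAlgebra G).le))
  have adjoin_mk : Algebra.adjoin K (mk '' s) = ⊤ := by
    refine adjoin_eq_top_of_range_algebraMap_le (S := MvPolynomial (Fin n) K) ?_ ?_
    · rintro _ ⟨p, rfl⟩
      exact ⟨_, (algebraMap_fiber_eq _ p).symm⟩
    · rw [← AlgHom.map_adjoin, adjoin_preimage_monomial_image_eq_top, Algebra.map_top,
        AlgHom.range_eq_top]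
      exact Ideal.Quotient.mkₐ_surjective _ _
  have surjective_mk : Function.Surjective
      ((mk.restrictScalars K).comp (Algebra.adjoin K s).val) := by
    rw [← AlgHom.range_eq_top, AlgHom.range_comp, Subalgebra.range_val, AlgHom.map_adjoin]
    exact adjoin_mk
  calc ringKrullDim (Fiber (Ideal.span G)) ≤ ringKrullDim (Algebra.adjoin K s) :=
        ringKrullDim_le_of_surjective _ surjective_mk
    _ = ringKrullDim ((Algebra.adjoin K s).map (R.val.restrictScalars K)) :=
        ringKrullDim_eq_of_ringEquiv
          (Subalgebra.equivMapOfInjective _ _ Subtype.val_injective).toRingEquiv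
    _ = ringKrullDim (Algebra.adjoin K (Polynomial.monomial 1 '' G)) := by
        rw [AlgHom.map_adjoin]
        exact congrArg (fun t => ringKrullDim (Algebra.adjoin K t)) hs

theorem analyticSpread_span_le_coneRank {A : Set (Fin n →₀ ℕ)} (hA : A.Finite) :
    analyticSpread (Ideal.span ((monomial · (1 : K)) '' A)) ≤ coneRank A := by
  refine (ringKrullDim_fiber_le _).trans ?_
  rw [Set.image_image]
  exact ringKrullDim_adjoin_monomial_le_coneRank K hA

theorem analyticSpread_nonneg (I : Ideal (MvPolynomial (Fin n) K)) : 0 ≤ analyticSpread I :=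
  ringKrullDim_nonneg_of_nontrivial

end Fiber

variable {K : Type*} [Field K] {n : ℕ}

open scoped Pointwise in
theorem exists_analyticSpread_initialDegreePart (m : MonomialOrder (Fin n))
    {I : Ideal (MvPolynomial (Fin n) K)} (hI : IsEquigenerated I) :
    ∃ l : ℕ, analyticSpread (initialDegreePart m I) = l ∧
      (mu (I ^ 2) : ℤ) ≥ (l : ℤ) * (mu I : ℤ) - (l.choose 2 : ℤ) := by
  obtain ⟨d, G, hG, rfl⟩ := hI
  set A := leadingExponents m (Submodule.span K G)
  have := finiteDimensional_span_of_isHomogeneous hG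
  have hA : A.Finite := finite_leadingExponents m _
  have hmu : mu (Ideal.span G) = A.ncard :=
    spanFinrank_ideal_span_eq_ncard_leadingExponents m hG
  have hmu_sq : (A + A).ncard ≤ mu (Ideal.span G ^ 2) :=
    ncard_leadingExponents_add_le_spanFinrank_sq m hG
  have hspread : analyticSpread (initialDegreePart m (Ideal.span G)) ≤ coneRank A :=
    initialDegreePart_span m hG ▸ analyticSpread_span_le_coneRank hA
  obtain ⟨l, hl, hlr⟩ := exists_natCast_eq_of_nonneg_of_le (analyticSpread_nonneg _) hspread
  refine ⟨l, hl, ?_⟩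
  have hmono := mul_add_choose_two_le hlr (coneRank_le_ncard hA)
  have hfreiman := coneRank_mul_ncard_le_ncard_add_self_add_choose m hA
  rw [hmu, ge_iff_le, sub_le_iff_le_add]
  norm_cast
  linarith

end FiberRing

theorem theorem1p9 {K : Type*} [Field K] {n : ℕ}
    (I : Ideal (MvPolynomial (Fin n) K)) (hI : FiberRing.IsEquigenerated I) :
    (∀ m : MonomialOrder (Fin n),
      ∃ l : ℕ, FiberRing.analyticSpread (FiberRing.initialDegreePart m I) = l ∧
        (FiberRing.mu (I ^ 2) : ℤ) ≥ (l : ℤ) * (FiberRing.mu I : ℤ) - (l.choose 2 : ℤ)) ∧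
    (FiberRing.IsMonomialIdeal I →
      ∃ l : ℕ, FiberRing.analyticSpread I = l ∧
        (FiberRing.mu (I ^ 2) : ℤ) ≥ (l : ℤ) * (FiberRing.mu I : ℤ) - (l.choose 2 : ℤ)) := by
  refine ⟨fun m => FiberRing.exists_analyticSpread_initialDegreePart m hI, fun hmon => ?_⟩
  have h := FiberRing.exists_analyticSpread_initialDegreePart MonomialOrder.lex hI
  rwa [FiberRing.initialDegreePart_eq_self _ hI hmon] at h
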